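/- Let $n\ge 1$, and let $a_0,\dots,a_n$ and $b_0,\dots,b_n$ be integers with $a_i\le b_i$, $a_0=0$, $0\le a_1-a_0\le a_2-a_1\le\dots\le a_n-a_{n-1}\le 1$ and $1\ge b_1-b_0\ge b_2-b_1\ge\dots\ge b_n-b_{n-1}\ge 0$. Put $V=\{(i,j)\in\mathbb Z^2: 0\le i\le n,\ a_i\le j\le b_i\}$ (a convex configuration). For an array $X=(x_{ij})\in\mathbb R^V$ let $\partial x_{ij}=x_{ij}-x_{i,j-1}$ for $0\le i\le n$, $a_i+1\le j\le b_i$. Call $X$ strip-concave if, for $0\le i<n$, $\partial x_{i+1,j}\ge\partial x_{ij}$ and $\partial x_{ij}\ge\partial x_{i+1,j+1}$ for all $j$ for which both sides of the respective inequality are defined. Given integer tuples $\lambda=(\lambda_{a_n+1},\dots,\lambda_{b_n})$, $\overline\lambda=(\overline\lambda_1,\dots,\overline\lambda_{b_0})$ and $\mu,\nu\in\mathbb Z^n$, let $\mathcal{SC}(\lambda\setminus\overline\lambda,\mu,\nu)\subseteq\mathbb R^V$ be the set of strip-concave arrays $X$ with $x_{00}=0$ such that $\partial x_{nj}=\lambda_j$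 for $a_n+1\le j\le b_n$, $\partial x_{0j}=\overline\lambda_j$ for $1\le j\le b_0$, and $x_{ia_i}-x_{i-1,a_{i-1}}=\mu_i$, $x_{ib_i}-x_{i-1,b_{i-1}}=\nu_i$ for $1\le i\le n$. Then the down hull $\mathcal D=\mathcal{SC}(\lambda\setminus\overline\lambda,\mu,\nu)-\mathbb R^V_+$ is an integral polyhedron: it is the solution set of a finite system of linear inequalities, and each nonempty face of it (the set of maximizers over $\mathcal D$ of a linear functional, $\mathcal D$ itself included) contains an integer point. -/

import Mathlib

open scoped Pointwise

/-- A convex configuration with rows `0, …, n`: row `i` occupies the columns `a i, …, b i`.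
Only the values `a i`, `b i` with `i ≤ n` matter. -/
structure ConvexShape (n : ℕ) where
  a : ℕ → ℤ
  b : ℕ → ℤ
  a_le_b : ∀ i ≤ n, a i ≤ b i
  a_zero : a 0 = 0
  a_step_nonneg : ∀ i < n, 0 ≤ a (i + 1) - a i
  a_step_le_one : ∀ i < n, a (i + 1) - a i ≤ 1
  a_step_mono : ∀ i, i + 1 < n → a (i + 1) - a i ≤ a (i + 2) - a (i + 1)
  b_step_nonneg : ∀ i < n, 0 ≤ b (i + 1) - b i
  b_step_le_one : ∀ i < n, b (i + 1) - b i ≤ 1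
  b_step_anti : ∀ i, i + 1 < n → b (i + 2) - b (i + 1) ≤ b (i + 1) - b i

namespace ConvexShape

variable {n : ℕ} (C : ConvexShape n)

/-- The set of index pairs of the configuration. -/
def V : Set (ℕ × ℤ) := {p | p.1 ≤ n ∧ C.a p.1 ≤ p.2 ∧ p.2 ≤ C.b p.1}

/-- Arrays of the given configuration, i.e. the space `ℝ^V`. -/
abbrev Arr : Type := C.V → ℝ

open Classical in
/-- The entry `x_{ij}` of an array (with value `0` outside the configuration; the definitions
below only use entries inside it). -/
noncomputable def entry (X : C.Arr) (i : ℕ) (j : ℤ) : ℝ :=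
  if h : (i, j) ∈ C.V then X ⟨(i, j), h⟩ else 0

/-- The pair `(i, j)` is an index of the row derivative: both `(i, j - 1)` and `(i, j)` lie
in the configuration. -/
def IsDerivIndex (i : ℕ) (j : ℤ) : Prop := i ≤ n ∧ C.a i + 1 ≤ j ∧ j ≤ C.b i

/-- The row derivative `∂x_{ij} = x_{ij} - x_{i,j-1}`. -/
noncomputable def rowDeriv (X : C.Arr) (i : ℕ) (j : ℤ) : ℝ :=
  C.entry X i j - C.entry X i (j - 1)

/-- Strip-concavity: `∂x_{i+1,j} ≥ ∂x_{ij} ≥ ∂x_{i+1,j+1}`, each inequality being required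
whenever both of its sides are defined. -/
def IsStripConcave (X : C.Arr) : Prop :=
  (∀ i j, C.IsDerivIndex i j → C.IsDerivIndex (i + 1) j →
      C.rowDeriv X i j ≤ C.rowDeriv X (i + 1) j) ∧
  (∀ i j, C.IsDerivIndex i j → C.IsDerivIndex (i + 1) (j + 1) →
      C.rowDeriv X (i + 1) (j + 1) ≤ C.rowDeriv X i j)

/-- The lower boundary tuple `λ^X = (∂x_{nj})`, `j = a_n + 1, …, b_n`. -/
noncomputable def lower (X : C.Arr) : Set.Icc (C.a n + 1) (C.b n) → ℝ :=
  fun j => C.rowDeriv X n j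

/-- The upper boundary tuple `(∂x_{0j})`, `j = 1, …, b_0`. -/
noncomputable def upper (X : C.Arr) : Set.Icc 1 (C.b 0) → ℝ :=
  fun j => C.rowDeriv X 0 j

/-- The left boundary tuple; the component with index `i : Fin n` is
`μ^X_{i+1} = x_{i+1,a_{i+1}} - x_{i,a_i}`. -/
noncomputable def left (X : C.Arr) : Fin n → ℝ :=
  fun i => C.entry X (i + 1) (C.a (i + 1)) - C.entry X i (C.a i)

/-- The right boundary tuple; the component with index `i : Fin n` is
`ν^X_{i+1} = x_{i+1,b_{i+1}} - x_{i,b_i}`. -/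
noncomputable def right (X : C.Arr) : Fin n → ℝ :=
  fun i => C.entry X (i + 1) (C.b (i + 1)) - C.entry X i (C.b i)

/-- The set of strip-concave arrays with `x_{00} = 0` and prescribed boundary tuples. -/
def SC (lam : Set.Icc (C.a n + 1) (C.b n) → ℝ) (lamBar : Set.Icc 1 (C.b 0) → ℝ)
    (mu nu : Fin n → ℝ) : Set C.Arr :=
  {X | C.IsStripConcave X ∧ C.entry X 0 0 = 0 ∧
    C.lower X = lam ∧ C.upper X = lamBar ∧ C.left X = mu ∧ C.right X = nu}

end ConvexShape

/-- The down hull `P - ℝ^ι_+`. -/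
def downHull {ι : Type*} (P : Set (ι → ℝ)) : Set (ι → ℝ) := P - {R | ∀ v, 0 ≤ R v}

/-- A polyhedron: the solution set of a finite system of linear inequalities. -/
def IsPolyhedron {ι : Type*} (P : Set (ι → ℝ)) : Prop :=
  ∃ (k : ℕ) (l : Fin k → ((ι → ℝ) →ₗ[ℝ] ℝ)) (c : Fin k → ℝ), P = {x | ∀ t, l t x ≤ c t}

/-- An integral polyhedron: a polyhedron each of whose nonempty faces contains an integer point.
A nonempty face of `P` is the nonempty set of maximizers over `P` of a linear functional
(the zero functional gives `P` itself). -/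
def IsIntegralPolyhedron {ι : Type*} (P : Set (ι → ℝ)) : Prop :=
  IsPolyhedron P ∧ ∀ F : Set (ι → ℝ), IsExposed ℝ P F → F.Nonempty →
    ∃ x ∈ F, ∀ v, ∃ z : ℤ, x v = z

/-! The strip-concave arrays form a polyhedron, and subtracting the orthant is a projection, so
Fourier–Motzkin elimination (`IsPolyhedron.downHull`) keeps it one.

For integrality, a functional `l` attaining its maximum over the down hull is nonnegative on
nonnegative arrays and attains that maximum on strip-concave arrays. Bound all row derivatives by a
large integer to get compactness, break ties among maximizers of `l` by the sum of entries, and take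
an extreme point `X` of what remains. If horizontally adjacent row derivatives of `X` shared a
non-integral value `c`, raising the entries strictly inside the runs of `c` would be feasible
(`exists_nonneg_direction`) and would increase the sum without lowering `l`. Otherwise equal
non-integral values in consecutive rows are linked injectively, so they form chains. Each row sums
to an integer, so a transition between rows where some chain starts or ends has at least two such
ends. Hence there are at most as many such transitions as chains, and as one row-sum equation is
redundant, a nonzero perturbation constant on chains with zero row sums exists
(`exists_balanced_perturbation`). It moves `X` both ways, against extremality. So all row
derivatives are integral, and so are all entries. -/

/-! ### Polyhedra and Fourier–Motzkin elimination. -/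

theorem isPolyhedron_of_finite {ι κ : Type*} [Finite κ] (l : κ → ((ι → ℝ) →ₗ[ℝ] ℝ)) (c : κ → ℝ) :
    IsPolyhedron {x | ∀ t, l t x ≤ c t} := by
  obtain ⟨k, ⟨e⟩⟩ := Finite.exists_equiv_fin κ
  refine ⟨k, fun t => l (e.symm t), fun t => c (e.symm t), ?_⟩
  ext x
  exact ⟨fun h t => h _, fun h t => by simpa using h (e t)⟩

theorem IsPolyhedron.iInter {ι κ : Type*} [Finite κ] {P : κ → Set (ι → ℝ)}
    (h : ∀ t, IsPolyhedron (P t)) : IsPolyhedron (⋂ t, P t) := by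
  choose k l c hP using h
  convert isPolyhedron_of_finite (κ := Σ t, Fin (k t)) (fun s => l s.1 s.2) (fun s => c s.1 s.2)
    using 1
  ext x
  simp [hP, Sigma.forall]

theorem IsPolyhedron.inter {ι : Type*} {P Q : Set (ι → ℝ)} (hP : IsPolyhedron P)
    (hQ : IsPolyhedron Q) : IsPolyhedron (P ∩ Q) := by
  rw [Set.inter_eq_iInter]
  exact IsPolyhedron.iInter fun b => by cases b <;> assumption

theorem isPolyhedron_le {ι : Type*} (l l' : (ι → ℝ) →ₗ[ℝ] ℝ) :
    IsPolyhedron {x | l x ≤ l' x} := by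
  convert isPolyhedron_of_finite (κ := Unit) (fun _ => l - l') (fun _ => 0) using 1
  ext x
  simp

theorem isPolyhedron_eq_const {ι : Type*} (l : (ι → ℝ) →ₗ[ℝ] ℝ) (c : ℝ) :
    IsPolyhedron {x | l x = c} := by
  convert isPolyhedron_of_finite (κ := Bool) (fun b => if b then l else -l)
    (fun b => if b then c else -c) using 1
  ext x
  simp only [Set.mem_ofPred_eq, Bool.forall_bool]
  simp only [Bool.false_eq_true, if_false, if_true, LinearMap.neg_apply, neg_le_neg_iff]
  exact ⟨fun h => ⟨h.ge, h.le⟩, fun h => le_antisymm h.2 h.1⟩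

/-- A finite system of bounds on one nonnegative real is solvable as soon as the
pairwise consequences hold. -/
theorem exists_nonneg_forall_add_mul_le {κ : Type*} [Finite κ] (α p c : κ → ℝ)
    (h0 : ∀ t, 0 ≤ α t → p t ≤ c t)
    (h1 : ∀ s t, 0 < α s → α t < 0 → p s * (-α t) + p t * α s ≤ c s * (-α t) + c t * α s) :
    ∃ r, 0 ≤ r ∧ ∀ t, p t + r * α t ≤ c t := by
  classical
  cases nonempty_fintype κ
  -- Every `t` with `α t < 0` is a lower bound on `r`; the largest of these and `0` is the witness.
  let S : Finset ℝ := insert 0 ((Finset.univ.filter fun t => α t < 0).image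
    fun t => (p t - c t) / (-α t))
  have hS : S.Nonempty := ⟨0, Finset.mem_insert_self _ _⟩
  refine ⟨S.max' hS, S.le_max' _ (Finset.mem_insert_self _ _), fun t => ?_⟩
  rcases lt_or_ge (α t) 0 with ht | ht
  · have hm : (p t - c t) / (-α t) ≤ S.max' hS := S.le_max' _ (Finset.mem_insert_of_mem
      (Finset.mem_image_of_mem _ (by simpa using ht)))
    rw [div_le_iff₀ (by linarith)] at hm
    linarith
  · rcases Finset.mem_insert.1 (S.max'_mem hS) with h | h
    · rw [h]; linarith [h0 t ht]
    · obtain ⟨s, hs, h⟩ := Finset.mem_image.1 h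
      have hs : α s < 0 := by simpa using hs
      rw [← h]
      rcases ht.eq_or_lt with ht | ht
      · rw [← ht]; linarith [h0 t ht.le]
      · have hs' : 0 < -α s := by linarith
        have := h1 t s ht hs
        rw [div_mul_eq_mul_div, ← le_sub_iff_add_le', div_le_iff₀ hs']
        linarith

/-- Fourier–Motzkin elimination along a ray. -/
theorem IsPolyhedron.exists_add_smul_mem {ι : Type*} {P : Set (ι → ℝ)} (hP : IsPolyhedron P)
    (e : ι → ℝ) : IsPolyhedron {x | ∃ r : ℝ, 0 ≤ r ∧ x + r • e ∈ P} := by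
  classical
  obtain ⟨k, l, c, rfl⟩ := hP
  -- If `e` does not decrease `l t`, that inequality is weakest at `r = 0`. The other consequences
  -- pair opposite signs with weights that cancel `r`.
  have h0 : IsPolyhedron {x | ∀ t : {t // 0 ≤ l t e}, l t x ≤ c t} :=
    isPolyhedron_of_finite (fun t : {t // 0 ≤ l t e} => l t) (fun t => c t)
  have h1 := isPolyhedron_of_finite
    (fun q : {t // 0 < l t e} × {t // l t e < 0} => (-l q.2 e) • l q.1 + (l q.1 e) • l q.2)
    (fun q => c q.1 * (-l q.2 e) + c q.2 * (l q.1 e))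
  convert h0.inter h1 using 1
  ext x
  constructor
  · rintro ⟨r, hr, hx⟩
    have hx : ∀ t, l t x + r * l t e ≤ c t := fun t => by simpa using hx t
    refine ⟨fun t => ?_, fun q => ?_⟩
    · have := mul_nonneg hr t.2
      linarith [hx t]
    · have e1 := mul_le_mul_of_nonneg_left (hx q.1) (neg_nonneg.2 q.2.2.le)
      have e2 := mul_le_mul_of_nonneg_left (hx q.2) q.1.2.le
      simp only [LinearMap.add_apply, LinearMap.smul_apply, smul_eq_mul]
      linarith
  · rintro ⟨h0, h1⟩
    obtain ⟨r, hr, h⟩ := exists_nonneg_forall_add_mul_le (fun t => l t e) (fun t => l t x) c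
      (fun t ht => h0 ⟨t, ht⟩) (fun s t hs ht => by
        have := h1 (⟨s, hs⟩, ⟨t, ht⟩)
        simp only [LinearMap.add_apply, LinearMap.smul_apply, smul_eq_mul] at this
        linarith)
    exact ⟨r, hr, fun t => by simpa using h t⟩

theorem IsPolyhedron.downHull {ι : Type*} [Finite ι] {P : Set (ι → ℝ)} (hP : IsPolyhedron P) :
    IsPolyhedron (downHull P) := by
  classical
  cases nonempty_fintype ι
  -- Coordinates are eliminated one at a time; `s` holds those already allowed to be lowered.
  have key : ∀ s : Finset ι, IsPolyhedron
      {x | ∃ r : ι → ℝ, (∀ v, 0 ≤ r v) ∧ (∀ v, v ∉ s → r v = 0) ∧ x + r ∈ P} := by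
    intro s
    induction s using Finset.induction_on with
    | empty =>
      convert hP using 1
      ext x
      constructor
      · rintro ⟨r, -, h, hx⟩
        obtain rfl : r = 0 := funext fun v => h v (Finset.notMem_empty v)
        simpa using hx
      · exact fun hx => ⟨0, by simp, by simp, by simpa using hx⟩
    | insert a s ha ih =>
      convert ih.exists_add_smul_mem (Pi.single a 1) using 1
      ext x
      constructor
      · rintro ⟨r, h0, h, hx⟩
        refine ⟨r a, h0 a, Function.update r a 0, fun v => ?_, fun v hv => ?_, ?_⟩
        · by_cases hva : v = a
          · simp [hva]
          · simpa [hva] using h0 v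
        · by_cases hva : v = a
          · simp [hva]
          · simpa [hva] using h v (by simp [hva, hv])
        · convert hx using 1
          ext v
          by_cases hva : v = a
          · subst hva; simp
          · simp [hva]
      · rintro ⟨t, ht, r, h0, h, hx⟩
        refine ⟨t • Pi.single a 1 + r, fun v => ?_, fun v hv => ?_, by rwa [← add_assoc]⟩
        · by_cases hva : v = a
          · subst hva; simpa using add_nonneg ht (h0 v)
          · simpa [hva] using h0 v
        · simp only [Finset.mem_insert, not_or] at hv
          simpa [hv.1] using h v hv.2
  convert key Finset.univ using 1
  ext x
  simp only [_root_.downHull, Set.mem_sub, Set.mem_ofPred_eq, Finset.mem_univ, not_true_eq_false,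
    false_imp_iff, implies_true, true_and]
  constructor
  · rintro ⟨p, hp, r, hr, rfl⟩
    exact ⟨r, hr, by simpa using hp⟩
  · rintro ⟨r, hr, h⟩
    exact ⟨_, h, r, hr, by simp⟩

/-! ### Counting argument for linked values with integral row sums. -/

/-- Passing from one row to the next, the sum of a function that is constant along the links
changes only by the contribution of the unlinked elements. -/
theorem sum_row_succ_sub_sum_row {ι : Type*} [DecidableEq ι] (K : Finset ι) (row : ι → ℕ)
    (M : Finset (ι × ι)) (hM : ∀ m ∈ M, m.1 ∈ K ∧ m.2 ∈ K ∧ row m.2 = row m.1 + 1)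
    (hfst : Set.InjOn Prod.fst (M : Set (ι × ι))) (hsnd : Set.InjOn Prod.snd (M : Set (ι × ι)))
    (g : ι → ℝ) (hg : ∀ m ∈ M, g m.1 = g m.2) (i : ℕ) :
    ∑ u ∈ K with row u = i + 1, g u - ∑ u ∈ K with row u = i, g u =
      ∑ u ∈ K \ M.image Prod.snd with row u = i + 1, g u -
        ∑ u ∈ K \ M.image Prod.fst with row u = i, g u := by
  have split : ∀ (A : Finset ι) (j : ℕ), A ⊆ K → ∑ u ∈ K with row u = j, g u =
      ∑ u ∈ K \ A with row u = j, g u + ∑ u ∈ A with row u = j, g u := by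
    intro A j hA
    simp only [Finset.sum_filter]
    exact (Finset.sum_sdiff hA).symm
  have h1 : M.image Prod.snd ⊆ K := Finset.image_subset_iff.2 fun m hm => (hM m hm).2.1
  have h2 : M.image Prod.fst ⊆ K := Finset.image_subset_iff.2 fun m hm => (hM m hm).1
  have h3 : ∑ u ∈ M.image Prod.snd with row u = i + 1, g u =
      ∑ u ∈ M.image Prod.fst with row u = i, g u := by
    simp only [Finset.sum_filter]
    rw [Finset.sum_image hsnd, Finset.sum_image hfst]
    refine Finset.sum_congr rfl fun m hm => ?_
    simp [(hM m hm).2.2, hg m hm]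
  rw [split _ _ h1, split _ _ h2, h3]
  ring

/-- Non-integral values with integral row sums, where equal values in consecutive rows may be
linked injectively, admit a nonzero perturbation constant along links with zero row sums. -/
theorem exists_balanced_perturbation {ι : Type*} [DecidableEq ι] (K : Finset ι) (row : ι → ℕ)
    (M : Finset (ι × ι)) (n : ℕ) (f : ι → ℝ) (hK : K.Nonempty)
    (hM : ∀ m ∈ M, m.1 ∈ K ∧ m.2 ∈ K ∧ row m.2 = row m.1 + 1)
    (hfM : ∀ m ∈ M, f m.1 = f m.2)
    (hfst : Set.InjOn Prod.fst (M : Set (ι × ι))) (hsnd : Set.InjOn Prod.snd (M : Set (ι × ι)))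
    (hrow : ∀ u ∈ K, 0 < row u ∧ row u < n)
    (hf : ∀ u ∈ K, ¬ ∃ z : ℤ, f u = z)
    (hsum : ∀ i, ∃ z : ℤ, ∑ u ∈ K with row u = i, f u = z) :
    ∃ z : ι → ℝ, (∃ u ∈ K, z u ≠ 0) ∧ (∀ u, u ∉ K → z u = 0) ∧ (∀ m ∈ M, z m.1 = z m.2) ∧
      ∀ i, ∑ u ∈ K with row u = i, z u = 0 := by
  have hdiff := sum_row_succ_sub_sum_row K row M hM hfst hsnd
  -- Links are injective both ways, so they cut `K` into chains: `heads` are the first elements,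
  -- `tails` the last, and both number `K.card - M.card`.
  set heads := K \ M.image Prod.snd with hheads
  set tails := K \ M.image Prod.fst with htails
  -- The transitions `i → i + 1` at which a chain starts in row `i + 1` or ends in row `i`. Rows in
  -- `K` are positive, so the subtraction does not truncate.
  set T : Finset ℕ := heads.image (fun u => row u - 1) ∪ tails.image row with hT
  have hhead_mem : ∀ u ∈ heads, u ∈ K := fun u hu => (Finset.mem_sdiff.1 hu).1
  have hcard_heads : heads.card + M.card = K.card := by
    rw [← Finset.card_image_of_injOn hsnd]
    exact Finset.card_sdiff_add_card_eq_card
      (Finset.image_subset_iff.2 fun m hm => (hM m hm).2.1)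
  have hcard_tails : tails.card + M.card = K.card := by
    rw [← Finset.card_image_of_injOn hfst]
    exact Finset.card_sdiff_add_card_eq_card
      (Finset.image_subset_iff.2 fun m hm => (hM m hm).1)
  have hheadfilter : ∀ i, heads.filter (fun u => row u - 1 = i) =
      heads.filter (fun u => row u = i + 1) := fun i => by
    refine Finset.filter_congr fun u hu => ?_
    have := (hrow u (hhead_mem u hu)).1
    omega
  have hT_two : ∀ i ∈ T, 2 ≤ (heads.filter (fun u => row u - 1 = i)).card +
      (tails.filter (fun u => row u = i)).card := by
    intro i hi
    rw [hheadfilter]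
    have hpos : 0 < (heads.filter (fun u => row u = i + 1)).card +
        (tails.filter (fun u => row u = i)).card := by
      rw [← hheadfilter]
      rcases Finset.mem_union.1 hi with h | h
      · obtain ⟨u, hu, rfl⟩ := Finset.mem_image.1 h
        exact Nat.add_pos_left (Finset.card_pos.2 ⟨u, by simp [hu]⟩) _
      · obtain ⟨u, hu, rfl⟩ := Finset.mem_image.1 h
        exact Nat.add_pos_right _ (Finset.card_pos.2 ⟨u, by simp [hu]⟩)
    -- A lone chain end would have its value equal, up to sign, to a difference of two integral row
    -- sums.
    by_contra! hlt
    have hd := hdiff f hfM i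
    obtain ⟨z1, h1⟩ := hsum (i + 1)
    obtain ⟨z2, h2⟩ := hsum i
    rw [h1, h2] at hd
    have hcases : ((heads.filter (fun u => row u = i + 1)).card = 1 ∧
        (tails.filter (fun u => row u = i)).card = 0) ∨
        ((heads.filter (fun u => row u = i + 1)).card = 0 ∧
        (tails.filter (fun u => row u = i)).card = 1) := by omega
    rcases hcases with ⟨ha, hb⟩ | ⟨ha, hb⟩
    · obtain ⟨u, hu⟩ := Finset.card_eq_one.1 ha
      rw [hu, Finset.card_eq_zero.1 hb, Finset.sum_singleton, Finset.sum_empty, sub_zero] at hd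
      have hu' : u ∈ heads := (Finset.mem_filter.1 (hu ▸ Finset.mem_singleton_self u)).1
      exact hf u (hhead_mem u hu') ⟨z1 - z2, by push_cast; exact hd.symm⟩
    · obtain ⟨u, hu⟩ := Finset.card_eq_one.1 hb
      rw [hu, Finset.card_eq_zero.1 ha, Finset.sum_singleton, Finset.sum_empty, zero_sub] at hd
      have hu' : u ∈ tails := (Finset.mem_filter.1 (hu ▸ Finset.mem_singleton_self u)).1
      exact hf u (Finset.mem_sdiff.1 hu').1 ⟨z2 - z1, by push_cast; linarith⟩
  have hT_card : T.card * 2 ≤ heads.card + tails.card := by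
    have e1 : heads.card = ∑ i ∈ T, (heads.filter (fun u => row u - 1 = i)).card :=
      Finset.card_eq_sum_card_fiberwise fun u hu =>
        Finset.mem_union_left _ (Finset.mem_image_of_mem _ hu)
    have e2 : tails.card = ∑ i ∈ T, (tails.filter (fun u => row u = i)).card :=
      Finset.card_eq_sum_card_fiberwise fun u hu =>
        Finset.mem_union_right _ (Finset.mem_image_of_mem _ hu)
    rw [e1, e2, ← Finset.sum_add_distrib]
    exact Finset.card_nsmul_le_sum T _ 2 hT_two
  obtain ⟨u0, hu0, hmin⟩ := K.exists_min_image row hK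
  have hu0h : u0 ∈ heads := by
    refine Finset.mem_sdiff.2 ⟨hu0, fun h => ?_⟩
    obtain ⟨m, hm, rfl⟩ := Finset.mem_image.1 h
    have h1 := hmin m.1 (hM m hm).1
    have h2 := (hM m hm).2.2
    omega
  have hp : row u0 - 1 ∈ T := Finset.mem_union_left _ (Finset.mem_image_of_mem _ hu0h)
  set p := row u0 - 1 with hp_def
  have hpn : p < n := by have := hrow u0 hu0; omega
  let ext : (K → ℝ) →ₗ[ℝ] (ι → ℝ) :=
    { toFun := fun z u => if h : u ∈ K then z ⟨u, h⟩ else 0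
      map_add' := fun z z' => by ext u; by_cases h : u ∈ K <;> simp [h]
      map_smul' := fun c z => by ext u; by_cases h : u ∈ K <;> simp [h] }
  let S : ℕ → (ι → ℝ) →ₗ[ℝ] ℝ := fun i => ∑ u ∈ K with row u = i, LinearMap.proj (R := ℝ) (φ := fun _ : ι => ℝ) u
  have hS : ∀ i z, S i z = ∑ u ∈ K with row u = i, z u := fun i z => by simp [S]
  -- There are `K.card` unknowns and `M.card + T.card - 1` equations: constancy on links, and equal
  -- consecutive row sums at the transitions in `T` other than `p`. As `T.card ≤ K.card - M.card`,
  -- the kernel is nonzero.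
  let L : (K → ℝ) →ₗ[ℝ] (M ⊕ (T.erase p : Finset ℕ) → ℝ) :=
    LinearMap.pi (Sum.elim
      (fun m => (LinearMap.proj (R := ℝ) (φ := fun _ : ι => ℝ) m.1.1 -
        LinearMap.proj (R := ℝ) (φ := fun _ : ι => ℝ) m.1.2) ∘ₗ ext)
      (fun i => (S (i.1 + 1) - S i.1) ∘ₗ ext))
  have hker : LinearMap.ker L ≠ ⊥ := by
    refine LinearMap.ker_ne_bot_of_finrank_lt ?_
    simp only [Module.finrank_fintype_fun_eq_card, Fintype.card_sum, Fintype.card_coe]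
    rw [Finset.card_erase_of_mem hp]
    have : 0 < T.card := Finset.card_pos.2 ⟨_, hp⟩
    omega
  obtain ⟨z, hz, hz0⟩ := (Submodule.ne_bot_iff _).1 hker
  have hz : L z = 0 := hz
  have hlink : ∀ m ∈ M, ext z m.1 = ext z m.2 := fun m hm => by
    have := congrFun hz (Sum.inl ⟨m, hm⟩)
    exact sub_eq_zero.1 this
  have hstep : ∀ i, i ≠ p → S (i + 1) (ext z) - S i (ext z) = 0 := by
    intro i hi
    by_cases hiT : i ∈ T
    · exact congrFun hz (Sum.inr ⟨i, Finset.mem_erase.2 ⟨hi, hiT⟩⟩)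
    · rw [hS, hS, hdiff _ hlink i, ← hheadfilter, Finset.filter_eq_empty_iff.2,
        Finset.filter_eq_empty_iff.2]
      · simp
      · rintro u hu rfl
        exact hiT (Finset.mem_union_right _ (Finset.mem_image_of_mem _ hu))
      · rintro u hu rfl
        exact hiT (Finset.mem_union_left _ (Finset.mem_image_of_mem (fun u => row u - 1) hu))
  have hend : ∀ i, i = 0 ∨ n ≤ i → S i (ext z) = 0 := fun i hi => by
    rw [hS, Finset.filter_eq_empty_iff.2, Finset.sum_empty]
    rintro u hu rfl
    have := hrow u hu
    omega
  have hstep' : ∀ i, S (i + 1) (ext z) - S i (ext z) = 0 := by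
    intro i
    by_cases hi : i = p
    · subst hi
      -- Rows `0` and `n` contain nothing of `K`, so the differences of row sums telescope to zero
      -- and the omitted equation at `p` follows.
      have htel := Finset.sum_range_sub (fun i => S i (ext z)) n
      rw [Finset.sum_eq_single p (fun j _ hj => hstep j hj)
        (fun h => absurd (Finset.mem_range.2 hpn) h), hend n (Or.inr le_rfl),
        hend 0 (Or.inl rfl), sub_zero] at htel
      exact htel
    · exact hstep i hi
  refine ⟨ext z, ?_, fun u hu => dif_neg hu, hlink, fun i => ?_⟩
  · obtain ⟨u, hu⟩ := Function.ne_iff.1 hz0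
    exact ⟨u, u.2, by simpa [ext] using hu⟩
  · rw [← hS]
    induction i with
    | zero => exact hend 0 (Or.inl rfl)
    | succ i ih => linarith [hstep' i]

/-! ### Telescoping, small perturbations and closedness. -/

open Filter Topology

theorem sum_Ioc_sub_pred (F : ℤ → ℝ) {a b : ℤ} (hab : a ≤ b) :
    ∑ j ∈ Finset.Ioc a b, (F j - F (j - 1)) = F b - F a := by
  induction b, hab using Int.leInduction with
  | base => simp
  | succ b hab ih =>
    rw [← Finset.insert_Ioc_right_eq_Ioc_add_one hab, Finset.sum_insert (by simp), ih,
      add_sub_cancel_right]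
    ring

theorem mem_range_castAddHom_iff {x : ℝ} :
    x ∈ (Int.castAddHom ℝ).range ↔ ∃ z : ℤ, x = z := by
  rw [AddMonoidHom.mem_range]
  exact exists_congr fun z => eq_comm

/-- A strict inequality survives by continuity; only a tight one constrains the slopes. -/
theorem eventually_add_mul_le_add_mul {p q u v : ℝ} (hpq : p ≤ q) (huv : p = q → u ≤ v) :
    ∀ᶠ ε in 𝓝[>] (0 : ℝ), p + ε * u ≤ q + ε * v := by
  rcases hpq.eq_or_lt with h | h
  · filter_upwards [self_mem_nhdsWithin] with ε hε
    have := mul_le_mul_of_nonneg_left (huv h) (le_of_lt (Set.mem_Ioi.1 hε))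
    linarith
  · have h1 : Tendsto (fun ε : ℝ => p + ε * u) (𝓝 0) (𝓝 p) := by
      have : Continuous fun ε : ℝ => p + ε * u := by fun_prop
      simpa using this.tendsto 0
    have h2 : Tendsto (fun ε : ℝ => q + ε * v) (𝓝 0) (𝓝 q) := by
      have : Continuous fun ε : ℝ => q + ε * v := by fun_prop
      simpa using this.tendsto 0
    exact ((h1.eventually_lt h2 h).mono fun _ h => h.le).filter_mono nhdsWithin_le_nhds

theorem IsPolyhedron.isClosed {ι : Type*} [Finite ι] {P : Set (ι → ℝ)} (hP : IsPolyhedron P) :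
    IsClosed P := by
  cases nonempty_fintype ι
  obtain ⟨k, l, c, rfl⟩ := hP
  rw [Set.ofPred_forall]
  exact isClosed_iInter fun t =>
    isClosed_le (l t).continuous_of_finiteDimensional continuous_const

/-! ### Arrays, their linear functionals, and polyhedrality of the strip-concave set. -/

namespace ConvexShape

variable {n : ℕ} (C : ConvexShape n)

instance : Finite C.V :=
  Finite.of_injective
    (fun v => (⟨⟨v.1.1, Nat.lt_succ_of_le v.2.1⟩, v.1.2, v.2.2⟩ :
      Σ i : Fin (n + 1), Set.Icc (C.a i) (C.b i)))
    (by
      rintro ⟨⟨i, j⟩, h⟩ ⟨⟨i', j'⟩, h'⟩ e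
      simp only [Sigma.mk.injEq, Fin.mk.injEq] at e
      obtain ⟨rfl, e⟩ := e
      have := congrArg Subtype.val (eq_of_heq e)
      simp only at this
      simp [this])

theorem finite_isDerivIndex : {p : ℕ × ℤ | C.IsDerivIndex p.1 p.2}.Finite :=
  (Set.toFinite C.V).subset fun p hp => ⟨hp.1, by have := hp.2.1; omega, hp.2.2⟩

variable {C}

theorem IsDerivIndex.mem {i : ℕ} {j : ℤ} (h : C.IsDerivIndex i j) : (i, j) ∈ C.V :=
  ⟨h.1, by have := h.2.1; simp only; omega, h.2.2⟩

theorem IsDerivIndex.pred_mem {i : ℕ} {j : ℤ} (h : C.IsDerivIndex i j) : (i, j - 1) ∈ C.V :=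
  ⟨h.1, by have := h.2.1; simp only; omega, by have := h.2.2; simp only; omega⟩

variable (C)

open Classical in
/-- The entry at a given place as a linear functional. -/
noncomputable def entryL (i : ℕ) (j : ℤ) : C.Arr →ₗ[ℝ] ℝ :=
  if h : (i, j) ∈ C.V then LinearMap.proj ⟨(i, j), h⟩ else 0

variable {C}

theorem entryL_apply (X : C.Arr) (i : ℕ) (j : ℤ) : C.entryL i j X = C.entry X i j := by
  unfold entryL entry
  split_ifs <;> simp

variable (C)

/-- The row derivative at a given place as a linear functional. -/
noncomputable def rowDerivL (i : ℕ) (j : ℤ) : C.Arr →ₗ[ℝ] ℝ :=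
  C.entryL i j - C.entryL i (j - 1)

variable {C}

theorem rowDerivL_apply (X : C.Arr) (i : ℕ) (j : ℤ) : C.rowDerivL i j X = C.rowDeriv X i j := by
  simp [rowDerivL, rowDeriv, entryL_apply]

theorem entry_add_smul (X Y : C.Arr) (ε : ℝ) (i : ℕ) (j : ℤ) :
    C.entry (X + ε • Y) i j = C.entry X i j + ε * C.entry Y i j := by
  simp [← entryL_apply]

theorem rowDeriv_add_smul (X Y : C.Arr) (ε : ℝ) (i : ℕ) (j : ℤ) :
    C.rowDeriv (X + ε • Y) i j = C.rowDeriv X i j + ε * C.rowDeriv Y i j := by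
  simp [← rowDerivL_apply]

theorem entry_coe (X : C.Arr) (v : C.V) : C.entry X v.1.1 v.1.2 = X v := by
  simp [entry]

variable (C)

/-- The array obtained by restricting a function of two indices. -/
def ofFun (f : ℕ → ℤ → ℝ) : C.Arr := fun v => f v.1.1 v.1.2

variable {C}

theorem entry_ofFun (f : ℕ → ℤ → ℝ) {i : ℕ} {j : ℤ} (h : (i, j) ∈ C.V) :
    C.entry (C.ofFun f) i j = f i j := by
  simp [entry, ofFun, h]

theorem rowDeriv_ofFun (f : ℕ → ℤ → ℝ) {i : ℕ} {j : ℤ} (h : C.IsDerivIndex i j) :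
    C.rowDeriv (C.ofFun f) i j = f i j - f i (j - 1) := by
  rw [rowDeriv, entry_ofFun f h.mem, entry_ofFun f h.pred_mem]

variable (C)

theorem isPolyhedron_SC (lam : Set.Icc (C.a n + 1) (C.b n) → ℝ) (lamBar : Set.Icc 1 (C.b 0) → ℝ)
    (mu nu : Fin n → ℝ) : IsPolyhedron (C.SC lam lamBar mu nu) := by
  have f1 : Finite {p : ℕ × ℤ // C.IsDerivIndex p.1 p.2 ∧ C.IsDerivIndex (p.1 + 1) p.2} :=
    (C.finite_isDerivIndex.subset fun p hp => hp.1).to_subtype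
  have f2 : Finite {p : ℕ × ℤ // C.IsDerivIndex p.1 p.2 ∧ C.IsDerivIndex (p.1 + 1) (p.2 + 1)} :=
    (C.finite_isDerivIndex.subset fun p hp => hp.1).to_subtype
  have h1 := IsPolyhedron.iInter fun
    p : {p : ℕ × ℤ // C.IsDerivIndex p.1 p.2 ∧ C.IsDerivIndex (p.1 + 1) p.2} =>
    isPolyhedron_le (C.rowDerivL p.1.1 p.1.2) (C.rowDerivL (p.1.1 + 1) p.1.2)
  have h2 := IsPolyhedron.iInter fun
    p : {p : ℕ × ℤ // C.IsDerivIndex p.1 p.2 ∧ C.IsDerivIndex (p.1 + 1) (p.2 + 1)} =>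
    isPolyhedron_le (C.rowDerivL (p.1.1 + 1) (p.1.2 + 1)) (C.rowDerivL p.1.1 p.1.2)
  have h3 := isPolyhedron_eq_const (C.entryL 0 0) 0
  have h4 := IsPolyhedron.iInter fun j : Set.Icc (C.a n + 1) (C.b n) =>
    isPolyhedron_eq_const (C.rowDerivL n j) (lam j)
  have h5 := IsPolyhedron.iInter fun j : Set.Icc 1 (C.b 0) =>
    isPolyhedron_eq_const (C.rowDerivL 0 j) (lamBar j)
  have h6 := IsPolyhedron.iInter fun i : Fin n =>
    isPolyhedron_eq_const (C.entryL (i + 1) (C.a (i + 1)) - C.entryL i (C.a i)) (mu i)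
  have h7 := IsPolyhedron.iInter fun i : Fin n =>
    isPolyhedron_eq_const (C.entryL (i + 1) (C.b (i + 1)) - C.entryL i (C.b i)) (nu i)
  convert (h1.inter h2).inter (h3.inter (h4.inter (h5.inter (h6.inter h7)))) using 1
  ext X
  simp only [SC, IsStripConcave, lower, upper, left, right, funext_iff, Set.mem_ofPred_eq,
    Set.mem_inter_iff, Set.mem_iInter, rowDerivL_apply, entryL_apply, LinearMap.sub_apply,
    Subtype.forall, Prod.forall, and_imp]

variable {C}

/-! ### Integral boundary data and feasible perturbations. -/

section Integral

variable {lam : Set.Icc (C.a n + 1) (C.b n) → ℤ} {lamBar : Set.Icc 1 (C.b 0) → ℤ}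
  {mu nu : Fin n → ℤ} {X : C.Arr}

theorem rowDeriv_bottom (hX : X ∈ C.SC (fun j => (lam j : ℝ)) (fun j => (lamBar j : ℝ))
    (fun i => (mu i : ℝ)) (fun i => (nu i : ℝ))) {j : ℤ} (hj : C.IsDerivIndex n j) :
    ∃ z : ℤ, C.rowDeriv X n j = z :=
  ⟨_, congrFun hX.2.2.1 ⟨j, hj.2⟩⟩

theorem rowDeriv_top (hX : X ∈ C.SC (fun j => (lam j : ℝ)) (fun j => (lamBar j : ℝ))
    (fun i => (mu i : ℝ)) (fun i => (nu i : ℝ))) {j : ℤ} (hj : C.IsDerivIndex 0 j) :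
    ∃ z : ℤ, C.rowDeriv X 0 j = z :=
  ⟨_, congrFun hX.2.2.2.1 ⟨j, by have := hj.2.1; rw [C.a_zero] at this; simpa using this, hj.2.2⟩⟩

theorem entry_left_int (hX : X ∈ C.SC (fun j => (lam j : ℝ)) (fun j => (lamBar j : ℝ))
    (fun i => (mu i : ℝ)) (fun i => (nu i : ℝ))) {i : ℕ} (hi : i ≤ n) :
    ∃ z : ℤ, C.entry X i (C.a i) = z := by
  induction i with
  | zero => exact ⟨0, by rw [C.a_zero, hX.2.1, Int.cast_zero]⟩
  | succ i ih =>
    obtain ⟨z, hz⟩ := ih (by omega)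
    have h : C.entry X (i + 1) (C.a (i + 1)) - C.entry X i (C.a i) = mu ⟨i, hi⟩ :=
      congrFun hX.2.2.2.2.1 ⟨i, hi⟩
    exact ⟨z + mu ⟨i, hi⟩, by push_cast; linarith⟩

theorem entry_int_of_rowDeriv_int (hX : X ∈ C.SC (fun j => (lam j : ℝ)) (fun j => (lamBar j : ℝ))
    (fun i => (mu i : ℝ)) (fun i => (nu i : ℝ))) {i : ℕ}
    (h : ∀ j, C.IsDerivIndex i j → ∃ z : ℤ, C.rowDeriv X i j = z) (hi : i ≤ n) {j : ℤ}
    (haj : C.a i ≤ j) (hjb : j ≤ C.b i) : ∃ z : ℤ, C.entry X i j = z := by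
  induction j, haj using Int.leInduction with
  | base => exact entry_left_int hX hi
  | succ j hj ih =>
    obtain ⟨z, hz⟩ := ih (by omega)
    obtain ⟨w, hw⟩ := h (j + 1) ⟨hi, by omega, hjb⟩
    rw [rowDeriv, add_sub_cancel_right] at hw
    exact ⟨w + z, by push_cast; linarith⟩

/-- The corner at the end of row `0` is reached through the integral top derivatives, and the right
side then descends by `nu`. -/
theorem entry_right_int (hX : X ∈ C.SC (fun j => (lam j : ℝ)) (fun j => (lamBar j : ℝ))
    (fun i => (mu i : ℝ)) (fun i => (nu i : ℝ))) {i : ℕ} (hi : i ≤ n) :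
    ∃ z : ℤ, C.entry X i (C.b i) = z := by
  induction i with
  | zero =>
    exact entry_int_of_rowDeriv_int hX (fun j hj => rowDeriv_top hX hj) hi (C.a_le_b 0 hi) le_rfl
  | succ i ih =>
    obtain ⟨z, hz⟩ := ih (by omega)
    have h : C.entry X (i + 1) (C.b (i + 1)) - C.entry X i (C.b i) = nu ⟨i, hi⟩ :=
      congrFun hX.2.2.2.2.2 ⟨i, hi⟩
    exact ⟨z + nu ⟨i, hi⟩, by push_cast; linarith⟩

/-- A perturbation that vanishes where the row derivative is integral, vanishes on the side
boundaries and respects all tight inequalities is feasible. -/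
theorem eventually_add_smul_mem_SC
    (hX : X ∈ C.SC (fun j => (lam j : ℝ)) (fun j => (lamBar j : ℝ))
      (fun i => (mu i : ℝ)) (fun i => (nu i : ℝ))) {Y : C.Arr}
    (hl : ∀ i ≤ n, C.entry Y i (C.a i) = 0) (hr : ∀ i ≤ n, C.entry Y i (C.b i) = 0)
    (hint : ∀ i j, C.IsDerivIndex i j → (∃ z : ℤ, C.rowDeriv X i j = z) → C.rowDeriv Y i j = 0)
    (h1 : ∀ i j, C.IsDerivIndex i j → C.IsDerivIndex (i + 1) j →
      C.rowDeriv X i j = C.rowDeriv X (i + 1) j → C.rowDeriv Y i j ≤ C.rowDeriv Y (i + 1) j)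
    (h2 : ∀ i j, C.IsDerivIndex i j → C.IsDerivIndex (i + 1) (j + 1) →
      C.rowDeriv X (i + 1) (j + 1) = C.rowDeriv X i j →
      C.rowDeriv Y (i + 1) (j + 1) ≤ C.rowDeriv Y i j)
    {M : ℤ} (hM : ∀ i j, C.IsDerivIndex i j → |C.rowDeriv X i j| ≤ M) :
    ∀ᶠ ε in 𝓝[>] (0 : ℝ),
      X + ε • Y ∈ C.SC (fun j => (lam j : ℝ)) (fun j => (lamBar j : ℝ))
        (fun i => (mu i : ℝ)) (fun i => (nu i : ℝ)) ∧
      ∀ i j, C.IsDerivIndex i j → |C.rowDeriv (X + ε • Y) i j| ≤ M := by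
  have f0 := C.finite_isDerivIndex
  have e1 : ∀ᶠ ε in 𝓝[>] (0 : ℝ), ∀ p ∈ {p : ℕ × ℤ | C.IsDerivIndex p.1 p.2},
      C.IsDerivIndex (p.1 + 1) p.2 →
      C.rowDeriv X p.1 p.2 + ε * C.rowDeriv Y p.1 p.2 ≤
        C.rowDeriv X (p.1 + 1) p.2 + ε * C.rowDeriv Y (p.1 + 1) p.2 :=
    (eventually_all_finite f0).2 fun p hp => eventually_imp_distrib_left.2 fun hp' =>
      eventually_add_mul_le_add_mul (hX.1.1 _ _ hp hp') (h1 _ _ hp hp')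
  have e2 : ∀ᶠ ε in 𝓝[>] (0 : ℝ), ∀ p ∈ {p : ℕ × ℤ | C.IsDerivIndex p.1 p.2},
      C.IsDerivIndex (p.1 + 1) (p.2 + 1) →
      C.rowDeriv X (p.1 + 1) (p.2 + 1) + ε * C.rowDeriv Y (p.1 + 1) (p.2 + 1) ≤
      C.rowDeriv X p.1 p.2 + ε * C.rowDeriv Y p.1 p.2 :=
    (eventually_all_finite f0).2 fun p hp => eventually_imp_distrib_left.2 fun hp' =>
      eventually_add_mul_le_add_mul (hX.1.2 _ _ hp hp') (h2 _ _ hp hp')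
  -- Since `M` is an integer, the bound is tight only at integral derivatives, where `Y` has
  -- derivative zero. Hence the artificial bound never obstructs the perturbation.
  have e3 : ∀ᶠ ε in 𝓝[>] (0 : ℝ), ∀ p ∈ {p : ℕ × ℤ | C.IsDerivIndex p.1 p.2},
      C.rowDeriv X p.1 p.2 + ε * C.rowDeriv Y p.1 p.2 ≤ M + ε * 0 :=
    (eventually_all_finite f0).2 fun p hp => eventually_add_mul_le_add_mul
      (abs_le.1 (hM _ _ hp)).2 fun h => (hint _ _ hp ⟨M, h⟩).le
  have e4 : ∀ᶠ ε in 𝓝[>] (0 : ℝ), ∀ p ∈ {p : ℕ × ℤ | C.IsDerivIndex p.1 p.2},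
      -(M : ℝ) + ε * 0 ≤ C.rowDeriv X p.1 p.2 + ε * C.rowDeriv Y p.1 p.2 :=
    (eventually_all_finite f0).2 fun p hp => eventually_add_mul_le_add_mul
      (abs_le.1 (hM _ _ hp)).1 fun h => (hint _ _ hp ⟨-M, by push_cast; exact h.symm⟩).ge
  filter_upwards [e1, e2, e3, e4] with ε e1 e2 e3 e4
  obtain ⟨-, h00, hlow, hup, hleft, hright⟩ := hX
  refine ⟨⟨⟨fun i j hij hij' => ?_, fun i j hij hij' => ?_⟩, ?_, ?_, ?_, ?_, ?_⟩,
    fun i j hij => ?_⟩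
  · simpa only [rowDeriv_add_smul] using e1 (i, j) hij hij'
  · simpa only [rowDeriv_add_smul] using e2 (i, j) hij hij'
  · rw [entry_add_smul, h00]
    have := hl 0 (Nat.zero_le n)
    rw [C.a_zero] at this
    rw [this, mul_zero, add_zero]
  · ext j
    have hj : C.IsDerivIndex n j := ⟨le_rfl, j.2⟩
    have := congrFun hlow j
    simp only [lower] at this ⊢
    rw [rowDeriv_add_smul, hint _ _ hj ⟨_, this⟩, this, mul_zero, add_zero]
  · ext j
    have hj : C.IsDerivIndex 0 j :=
      ⟨Nat.zero_le n, by rw [C.a_zero]; simpa using j.2.1, j.2.2⟩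
    have := congrFun hup j
    simp only [upper] at this ⊢
    rw [rowDeriv_add_smul, hint _ _ hj ⟨_, this⟩, this, mul_zero, add_zero]
  · rw [← hleft]
    ext i
    simp only [left, entry_add_smul, hl i i.2.le, hl (i + 1) i.2, mul_zero, add_zero]
  · rw [← hright]
    ext i
    simp only [right, entry_add_smul, hr i i.2.le, hr (i + 1) i.2, mul_zero, add_zero]
  · rw [rowDeriv_add_smul, abs_le]
    have := e3 (i, j) hij
    have := e4 (i, j) hij
    simp only [mul_zero, add_zero] at *
    constructor <;> assumption

end Integral

end ConvexShape

/-! ### The two perturbations of a non-integral array. -/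

namespace ConvexShape

variable {n : ℕ} {C : ConvexShape n}

section Integral

variable {lam : Set.Icc (C.a n + 1) (C.b n) → ℤ} {lamBar : Set.Icc 1 (C.b 0) → ℤ}
  {mu nu : Fin n → ℤ} {X : C.Arr}

open Classical in
/-- If two neighbouring row derivatives share a non-integral value, then some nonzero nonnegative
array is a feasible direction. -/
theorem exists_nonneg_direction
    (hX : X ∈ C.SC (fun j => (lam j : ℝ)) (fun j => (lamBar j : ℝ))
      (fun i => (mu i : ℝ)) (fun i => (nu i : ℝ)))
    {M : ℤ} (hM : ∀ i j, C.IsDerivIndex i j → |C.rowDeriv X i j| ≤ M)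
    {i₀ : ℕ} {j₀ : ℤ} (h₀ : C.IsDerivIndex i₀ j₀) (h₁ : C.IsDerivIndex i₀ (j₀ + 1))
    (heq : C.rowDeriv X i₀ (j₀ + 1) = C.rowDeriv X i₀ j₀)
    (hni : ¬ ∃ z : ℤ, C.rowDeriv X i₀ j₀ = z) :
    ∃ Y : C.Arr, 0 ≤ Y ∧ Y ≠ 0 ∧ ∃ ε : ℝ, 0 < ε ∧
      X + ε • Y ∈ C.SC (fun j => (lam j : ℝ)) (fun j => (lamBar j : ℝ))
        (fun i => (mu i : ℝ)) (fun i => (nu i : ℝ)) ∧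
      ∀ i j, C.IsDerivIndex i j → |C.rowDeriv (X + ε • Y) i j| ≤ M := by
  set c := C.rowDeriv X i₀ j₀ with hc
  -- `P i j` says that `(i, j)` lies strictly inside a horizontal run of derivatives equal to `c`.
  -- Its indicator has derivative `1` at the left end of a run of length at least two, `-1` at the
  -- right end, and `0` elsewhere.
  set P : ℕ → ℤ → Prop := fun i j => C.IsDerivIndex i j ∧ C.IsDerivIndex i (j + 1) ∧
    C.rowDeriv X i j = c ∧ C.rowDeriv X i (j + 1) = c with hP
  set f : ℕ → ℤ → ℝ := fun i j => if P i j then 1 else 0 with hf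
  have hYd : ∀ i j, C.IsDerivIndex i j → C.rowDeriv (C.ofFun f) i j = f i j - f i (j - 1) :=
    fun i j h => rowDeriv_ofFun f h
  have hzero : ∀ i j, C.IsDerivIndex i j → C.rowDeriv X i j ≠ c →
      C.rowDeriv (C.ofFun f) i j = 0 := by
    intro i j h hne
    rw [hYd i j h, hf]
    have p1 : ¬ P i j := fun h => hne h.2.2.1
    have p2 : ¬ P i (j - 1) := fun h => hne (by simpa using h.2.2.2)
    simp [p1, p2]
  have hmono : ∀ i j i' j', C.IsDerivIndex i j → C.IsDerivIndex i' j' →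
      (P i j → P i' j') → (P i' (j' - 1) → P i (j - 1)) →
      C.rowDeriv (C.ofFun f) i j ≤ C.rowDeriv (C.ofFun f) i' j' := by
    intro i j i' j' h h' h1 h2
    rw [hYd i j h, hYd i' j' h']
    have e1 : f i j ≤ f i' j' := by
      simp only [hf]
      split_ifs with q1 q2 q2
      · exact le_rfl
      · exact absurd (h1 q1) q2
      · exact zero_le_one
      · exact le_rfl
    have e2 : f i' (j' - 1) ≤ f i (j - 1) := by
      simp only [hf]
      split_ifs with q1 q2 q2
      · exact le_rfl
      · exact absurd (h2 q1) q2
      · exact zero_le_one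
      · exact le_rfl
    linarith
  have hev := eventually_add_smul_mem_SC hX (Y := C.ofFun f)
    (fun i hi => by
      rw [entry_ofFun f ⟨hi, le_rfl, C.a_le_b i hi⟩, hf]
      exact if_neg fun h => by have : C.a i + 1 ≤ C.a i := h.1.2.1; omega)
    (fun i hi => by
      rw [entry_ofFun f ⟨hi, C.a_le_b i hi, le_rfl⟩, hf]
      exact if_neg fun h => by have : C.b i + 1 ≤ C.b i := h.2.1.2.2; omega)
    (fun i j h hz => hzero i j h fun e => hni (e ▸ hz))
    (fun i j h h' e => by
      by_cases hxc : C.rowDeriv X i j = c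
      · have hi : i < n := h'.1
        have := C.a_step_nonneg i hi
        have := C.a_step_le_one i hi
        have := C.b_step_nonneg i hi
        have := C.b_step_le_one i hi
        have hjb := h.2
        have hjb' := h'.2
        refine hmono _ _ _ _ h h' (fun hp => ?_) fun hp => ?_
        -- By strip-concavity the new derivative lies between two derivatives in the other row, both
        -- equal to `c`. The same sandwich settles the next three cases.
        · have hq : C.IsDerivIndex (i + 1) (j + 1) :=
            ⟨h'.1, by omega, by have := hp.2.1.2.2; omega⟩
          refine ⟨h', hq, e ▸ hxc, le_antisymm ?_ ?_⟩
          · exact (hX.1.2 i j h hq).trans_eq hxc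
          · exact hp.2.2.2.symm.trans_le (hX.1.1 i (j + 1) hp.2.1 hq)
        · have hq : C.IsDerivIndex i (j - 1) :=
            ⟨h.1, by have := hp.1.2.1; omega, by omega⟩
          refine ⟨hq, by simpa using h, le_antisymm ?_ ?_, by simpa using hxc⟩
          · exact (hX.1.1 i (j - 1) hq hp.1).trans_eq hp.2.2.1
          · have := hX.1.2 i (j - 1) hq (by simpa using h')
            rw [sub_add_cancel, ← e, hxc] at this
            exact this
      · rw [hzero i j h hxc, hzero (i + 1) j h' (e ▸ hxc)])
    (fun i j h h' e => by
      by_cases hxc : C.rowDeriv X i j = c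
      · have hi : i < n := h'.1
        have := C.a_step_nonneg i hi
        have := C.a_step_le_one i hi
        have := C.b_step_nonneg i hi
        have := C.b_step_le_one i hi
        have hjb := h.2
        have hjb' := h'.2
        refine hmono _ _ _ _ h' h (fun hp => ?_) fun hp => ?_
        · have hq : C.IsDerivIndex i (j + 1) :=
            ⟨h.1, by omega, by have := hp.2.1.2.2; omega⟩
          refine ⟨h, hq, hxc, le_antisymm ?_ ?_⟩
          · exact (hX.1.1 i (j + 1) hq h').trans_eq (e.trans hxc)
          · exact hp.2.2.2.symm.trans_le (hX.1.2 i (j + 1) hq hp.2.1)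
        · have hq : C.IsDerivIndex (i + 1) j :=
            ⟨h'.1, by have := hp.1.2.1; omega, by omega⟩
          rw [add_sub_cancel_right]
          refine ⟨hq, h', le_antisymm ?_ ?_, e.trans hxc⟩
          · have := hX.1.2 i (j - 1) hp.1 (by simpa using hq)
            rw [sub_add_cancel, hp.2.2.1] at this
            exact this
          · exact hxc.symm.trans_le (hX.1.1 i j h hq)
      · rw [hzero i j h hxc, hzero (i + 1) (j + 1) h' (e.symm ▸ hxc)]) hM
  obtain ⟨ε, hε, hε0⟩ := (hev.and self_mem_nhdsWithin).exists
  refine ⟨C.ofFun f, fun v => ?_, fun h => ?_, ε, hε0, hε⟩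
  · simp only [ofFun, hf, Pi.zero_apply]
    split_ifs <;> norm_num
  · have := congrFun h ⟨(i₀, j₀), h₀.mem⟩
    have hp : P i₀ j₀ := ⟨h₀, h₁, rfl, heq⟩
    simp [ofFun, hf, hp] at this

/-- If a row derivative is non-integral and neighbouring row derivatives never share a
non-integral value, then the array is the midpoint of a segment of feasible arrays. -/
theorem exists_two_sided_direction
    (hX : X ∈ C.SC (fun j => (lam j : ℝ)) (fun j => (lamBar j : ℝ))
      (fun i => (mu i : ℝ)) (fun i => (nu i : ℝ)))
    {M : ℤ} (hM : ∀ i j, C.IsDerivIndex i j → |C.rowDeriv X i j| ≤ M)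
    (hadj : ∀ i j, C.IsDerivIndex i j → C.IsDerivIndex i (j + 1) →
      C.rowDeriv X i (j + 1) = C.rowDeriv X i j → ∃ z : ℤ, C.rowDeriv X i j = z)
    {i₀ : ℕ} {j₀ : ℤ} (h₀ : C.IsDerivIndex i₀ j₀) (hni : ¬ ∃ z : ℤ, C.rowDeriv X i₀ j₀ = z) :
    ∃ Y : C.Arr, Y ≠ 0 ∧
      (X + Y ∈ C.SC (fun j => (lam j : ℝ)) (fun j => (lamBar j : ℝ))
        (fun i => (mu i : ℝ)) (fun i => (nu i : ℝ)) ∧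
      ∀ i j, C.IsDerivIndex i j → |C.rowDeriv (X + Y) i j| ≤ M) ∧
      (X - Y ∈ C.SC (fun j => (lam j : ℝ)) (fun j => (lamBar j : ℝ))
        (fun i => (mu i : ℝ)) (fun i => (nu i : ℝ)) ∧
      ∀ i j, C.IsDerivIndex i j → |C.rowDeriv (X - Y) i j| ≤ M) := by
  classical
  have hKfin : {p : ℕ × ℤ | C.IsDerivIndex p.1 p.2 ∧ ¬ ∃ z : ℤ, C.rowDeriv X p.1 p.2 = z}.Finite :=
    C.finite_isDerivIndex.subset fun p hp => hp.1
  set K := hKfin.toFinset with hKdef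
  have hK : ∀ p, p ∈ K ↔ C.IsDerivIndex p.1 p.2 ∧ ¬ ∃ z : ℤ, C.rowDeriv X p.1 p.2 = z :=
    fun p => hKfin.mem_toFinset
  set L : Finset ((ℕ × ℤ) × (ℕ × ℤ)) := (K ×ˢ K).filter fun m => m.2.1 = m.1.1 + 1 ∧
    (m.2.2 = m.1.2 ∨ m.2.2 = m.1.2 + 1) ∧ C.rowDeriv X m.1.1 m.1.2 = C.rowDeriv X m.2.1 m.2.2
    with hLdef
  have hL : ∀ m, m ∈ L ↔ (m.1 ∈ K ∧ m.2 ∈ K) ∧ m.2.1 = m.1.1 + 1 ∧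
      (m.2.2 = m.1.2 ∨ m.2.2 = m.1.2 + 1) ∧
      C.rowDeriv X m.1.1 m.1.2 = C.rowDeriv X m.2.1 m.2.2 := fun m => by
    rw [hLdef, Finset.mem_filter, Finset.mem_product]
  have hdist : ∀ i j, (i, j) ∈ K → (i, j + 1) ∈ K →
      C.rowDeriv X i (j + 1) ≠ C.rowDeriv X i j := fun i j h h' e =>
    ((hK _).1 h).2 (hadj i j ((hK _).1 h).1 ((hK _).1 h').1 e)
  have hfst : Set.InjOn Prod.fst (L : Set ((ℕ × ℤ) × (ℕ × ℤ))) := by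
    rintro ⟨⟨i, j⟩, ⟨i', j'⟩⟩ h ⟨⟨k, l⟩, ⟨k', l'⟩⟩ h' e
    obtain ⟨⟨-, hm⟩, hi, hj, hv⟩ := (hL _).1 h
    obtain ⟨⟨-, hm'⟩, hi', hl, hw⟩ := (hL _).1 h'
    simp only [Prod.mk.injEq] at e hm hm' hi hi' hj hl hv hw
    obtain ⟨rfl, rfl⟩ := e
    subst hi hi'
    rcases hj with rfl | rfl <;> rcases hl with rfl | rfl
    · simp
    · exact absurd (hw.symm.trans hv) (hdist _ _ hm hm')
    · exact absurd (hv.symm.trans hw) (hdist _ _ hm' hm)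
    · simp
  have hsnd : Set.InjOn Prod.snd (L : Set ((ℕ × ℤ) × (ℕ × ℤ))) := by
    rintro ⟨⟨i, j⟩, ⟨i', j'⟩⟩ h ⟨⟨k, l⟩, ⟨k', l'⟩⟩ h' e
    obtain ⟨⟨hm, -⟩, hi, hj, hv⟩ := (hL _).1 h
    obtain ⟨⟨hm', -⟩, hi', hl, hw⟩ := (hL _).1 h'
    simp only [Prod.mk.injEq] at e hm hm' hi hi' hj hl hv hw
    obtain ⟨rfl, rfl⟩ := e
    obtain rfl : i = k := by omega
    -- Two sources of one target are equal or adjacent in their row; adjacent ones would share a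
    -- non-integral value.
    have hjl : j = l ∨ j = l + 1 ∨ l = j + 1 := by omega
    rcases hjl with rfl | rfl | rfl
    · simp
    · exact absurd (hv.trans hw.symm) (hdist _ _ hm' hm)
    · exact absurd (hw.trans hv.symm) (hdist _ _ hm hm')
  have hrowsum : ∀ (g : ℕ × ℤ → ℝ), (∀ u, u ∉ K → g u = 0) → ∀ i,
      ∑ u ∈ K with u.1 = i, g u = ∑ j ∈ Finset.Ioc (C.a i) (C.b i), g (i, j) := by
    intro g hg i
    rw [← Finset.sum_image (f := g) (s := Finset.Ioc (C.a i) (C.b i)) (g := fun j => (i, j))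
      (fun j _ j' _ e => congrArg Prod.snd e)]
    refine Finset.sum_subset (fun u hu => ?_) fun u hu hu' => ?_
    · obtain ⟨huK, rfl⟩ := Finset.mem_filter.1 hu
      have := ((hK u).1 huK).1.2
      exact Finset.mem_image.2 ⟨u.2, Finset.mem_Ioc.2 ⟨by omega, this.2⟩, rfl⟩
    · obtain ⟨j, -, rfl⟩ := Finset.mem_image.1 hu
      exact hg _ fun h => hu' (Finset.mem_filter.2 ⟨h, rfl⟩)
  have hsum : ∀ i, ∃ z : ℤ, ∑ u ∈ K with u.1 = i, C.rowDeriv X u.1 u.2 = z := by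
    intro i
    by_cases hi : i ≤ n
    · have e1 : ∑ u ∈ K with u.1 = i, C.rowDeriv X u.1 u.2 =
          ∑ u ∈ K with u.1 = i, if u ∈ K then C.rowDeriv X u.1 u.2 else 0 :=
        Finset.sum_congr rfl fun u hu => (if_pos (Finset.mem_filter.1 hu).1).symm
      have e2 : ∑ j ∈ Finset.Ioc (C.a i) (C.b i), (if (i, j) ∈ K then C.rowDeriv X i j else 0) =
          ∑ j ∈ Finset.Ioc (C.a i) (C.b i), C.rowDeriv X i j -
          ∑ j ∈ Finset.Ioc (C.a i) (C.b i), (if (i, j) ∈ K then 0 else C.rowDeriv X i j) := by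
        rw [← Finset.sum_sub_distrib]
        refine Finset.sum_congr rfl fun j _ => ?_
        split_ifs <;> simp
      -- The full row sum telescopes to the difference of its integral end entries; the derivatives
      -- outside `K` are integral and can be removed.
      rw [e1, hrowsum _ (fun u hu => if_neg hu) i, e2, ← mem_range_castAddHom_iff]
      refine AddSubgroup.sub_mem _ ?_ (AddSubgroup.sum_mem _ fun j hj => ?_)
      · unfold rowDeriv
        rw [sum_Ioc_sub_pred (C.entry X i) (C.a_le_b i hi)]
        exact AddSubgroup.sub_mem _ (mem_range_castAddHom_iff.2 (entry_right_int hX hi))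
          (mem_range_castAddHom_iff.2 (entry_left_int hX hi))
      · split_ifs with h
        · exact AddSubgroup.zero_mem _
        · rw [hK] at h
          rw [mem_range_castAddHom_iff]
          rw [Finset.mem_Ioc] at hj
          exact not_not.1 fun h' => h ⟨⟨hi, by simp only; omega, hj.2⟩, h'⟩
    · refine ⟨0, ?_⟩
      rw [Finset.filter_eq_empty_iff.2, Finset.sum_empty, Int.cast_zero]
      rintro u hu rfl
      exact hi ((hK u).1 hu).1.1
  obtain ⟨z, ⟨u, huK, hu⟩, hz0, hzL, hzsum⟩ := exists_balanced_perturbation K Prod.fst L n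
    (fun u => C.rowDeriv X u.1 u.2) ⟨(i₀, j₀), (hK _).2 ⟨h₀, hni⟩⟩
    (fun m hm => ⟨((hL m).1 hm).1.1, ((hL m).1 hm).1.2, ((hL m).1 hm).2.1⟩)
    (fun m hm => ((hL m).1 hm).2.2.2) hfst hsnd
    (fun u hu => by
      obtain ⟨⟨i, j⟩, hu⟩ : {v // v = u} := ⟨u, rfl⟩
      subst hu
      obtain ⟨h, h'⟩ := (hK _).1 hu
      refine ⟨Nat.pos_of_ne_zero ?_, lt_of_le_of_ne h.1 ?_⟩
      · rintro rfl
        exact h' (rowDeriv_top hX h)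
      · intro e
        simp only at e
        subst e
        exact h' (rowDeriv_bottom hX h))
    (fun u hu => ((hK u).1 hu).2) hsum
  -- Integrating `z` along each row gives zero on the left side as an empty sum and on the right
  -- side because row sums of `z` vanish.
  set f : ℕ → ℤ → ℝ := fun i j => ∑ k ∈ Finset.Ioc (C.a i) j, z (i, k) with hf
  have hYd : ∀ i j, C.IsDerivIndex i j → C.rowDeriv (C.ofFun f) i j = z (i, j) := by
    intro i j h
    rw [rowDeriv_ofFun f h]
    simp only [hf]
    have h1 : C.a i ≤ j - 1 := by have := h.2.1; omega
    have h2 := Finset.insert_Ioc_right_eq_Ioc_add_one h1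
    rw [sub_add_cancel] at h2
    rw [← h2, Finset.sum_insert (by simp)]
    ring
  have hYl : ∀ i ≤ n, C.entry (C.ofFun f) i (C.a i) = 0 := fun i hi => by
    rw [entry_ofFun f ⟨hi, le_rfl, C.a_le_b i hi⟩]
    simp [hf]
  have hYr : ∀ i ≤ n, C.entry (C.ofFun f) i (C.b i) = 0 := fun i hi => by
    rw [entry_ofFun f ⟨hi, C.a_le_b i hi, le_rfl⟩]
    exact (hrowsum z hz0 i).symm.trans (hzsum i)
  have hYi : ∀ i j, C.IsDerivIndex i j → (∃ z : ℤ, C.rowDeriv X i j = z) →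
      C.rowDeriv (C.ofFun f) i j = 0 := fun i j h hint => by
    rw [hYd i j h]
    exact hz0 _ fun hm => ((hK _).1 hm).2 hint
  have htight : ∀ i j j', C.IsDerivIndex i j → C.IsDerivIndex (i + 1) j' →
      (j' = j ∨ j' = j + 1) → C.rowDeriv X i j = C.rowDeriv X (i + 1) j' →
      C.rowDeriv (C.ofFun f) i j = C.rowDeriv (C.ofFun f) (i + 1) j' := by
    intro i j j' h h' hj e
    by_cases hint : ∃ z : ℤ, C.rowDeriv X i j = z
    · rw [hYi i j h hint, hYi (i + 1) j' h' (e ▸ hint)]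
    · rw [hYd i j h, hYd (i + 1) j' h']
      exact hzL ((i, j), (i + 1, j')) ((hL _).2
        ⟨⟨(hK _).2 ⟨h, hint⟩, (hK _).2 ⟨h', by rw [← e]; exact hint⟩⟩, rfl, hj, e⟩)
  have hneg_e : ∀ i j, C.entry (-C.ofFun f) i j = -C.entry (C.ofFun f) i j := fun i j => by
    simp [← entryL_apply]
  have hneg : ∀ i j, C.rowDeriv (-C.ofFun f) i j = -C.rowDeriv (C.ofFun f) i j := fun i j => by
    simp [← rowDerivL_apply]
  have ev1 := eventually_add_smul_mem_SC hX hYl hYr hYi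
    (fun i j h h' e => (htight i j j h h' (Or.inl rfl) e).le)
    (fun i j h h' e => (htight i j (j + 1) h h' (Or.inr rfl) e.symm).ge) hM
  have ev2 := eventually_add_smul_mem_SC hX (Y := -C.ofFun f)
    (fun i hi => by rw [hneg_e, hYl i hi, neg_zero]) (fun i hi => by rw [hneg_e, hYr i hi, neg_zero])
    (fun i j h hint => by rw [hneg, hYi i j h hint, neg_zero])
    (fun i j h h' e => by rw [hneg, hneg, htight i j j h h' (Or.inl rfl) e])
    (fun i j h h' e => by rw [hneg, hneg, htight i j (j + 1) h h' (Or.inr rfl) e.symm]) hM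
  obtain ⟨ε, ⟨h1, h2⟩, hε⟩ := ((ev1.and ev2).and self_mem_nhdsWithin).exists
  rw [smul_neg, ← sub_eq_add_neg] at h2
  refine ⟨ε • C.ofFun f, fun h => ?_, h1, h2⟩
  have hε : 0 < ε := hε
  rcases smul_eq_zero.1 h with h | h
  · exact hε.ne' h
  · have := hYd u.1 u.2 ((hK u).1 huK).1
    rw [h, ← rowDerivL_apply, map_zero] at this
    exact hu this.symm

/-! ### Compactness and an integral maximizer. -/

theorem entry_left_eq {X' : C.Arr}
    (hX : X ∈ C.SC (fun j => (lam j : ℝ)) (fun j => (lamBar j : ℝ))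
      (fun i => (mu i : ℝ)) (fun i => (nu i : ℝ)))
    (hX' : X' ∈ C.SC (fun j => (lam j : ℝ)) (fun j => (lamBar j : ℝ))
      (fun i => (mu i : ℝ)) (fun i => (nu i : ℝ))) {i : ℕ} (hi : i ≤ n) :
    C.entry X i (C.a i) = C.entry X' i (C.a i) := by
  induction i with
  | zero => rw [C.a_zero, hX.2.1, hX'.2.1]
  | succ i ih =>
    have h : C.entry X (i + 1) (C.a (i + 1)) - C.entry X i (C.a i) = mu ⟨i, hi⟩ :=
      congrFun hX.2.2.2.2.1 ⟨i, hi⟩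
    have h' : C.entry X' (i + 1) (C.a (i + 1)) - C.entry X' i (C.a i) = mu ⟨i, hi⟩ :=
      congrFun hX'.2.2.2.2.1 ⟨i, hi⟩
    linarith [ih (by omega)]

/-- Both arrays agree at the left end of each row, and each step to the right adds at most `2 * M`
to the gap. -/
theorem abs_entry_sub_entry_le {X' : C.Arr} {M : ℤ}
    (hX : X ∈ C.SC (fun j => (lam j : ℝ)) (fun j => (lamBar j : ℝ))
      (fun i => (mu i : ℝ)) (fun i => (nu i : ℝ)))
    (hM : ∀ i j, C.IsDerivIndex i j → |C.rowDeriv X i j| ≤ M)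
    (hX' : X' ∈ C.SC (fun j => (lam j : ℝ)) (fun j => (lamBar j : ℝ))
      (fun i => (mu i : ℝ)) (fun i => (nu i : ℝ)))
    (hM' : ∀ i j, C.IsDerivIndex i j → |C.rowDeriv X' i j| ≤ M) {i : ℕ} (hi : i ≤ n) {j : ℤ}
    (haj : C.a i ≤ j) (hjb : j ≤ C.b i) :
    |C.entry X i j - C.entry X' i j| ≤ 2 * M * (j - C.a i) := by
  induction j, haj using Int.leInduction with
  | base => simp [entry_left_eq hX hX' hi]
  | succ j hj ih =>
    have h0 : C.IsDerivIndex i (j + 1) := ⟨hi, by omega, hjb⟩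
    have h1 := abs_le.1 (hM i (j + 1) h0)
    have h2 := abs_le.1 (hM' i (j + 1) h0)
    have h3 := abs_le.1 (ih (by omega))
    rw [rowDeriv, add_sub_cancel_right] at h1 h2
    rw [abs_le]
    push_cast
    constructor <;> linarith

/-- The boundary data alone need not bound the strip-concave arrays; the bound on derivatives
supplies the compactness needed for extreme points. -/
theorem isCompact_SC_bounded (M : ℤ) :
    IsCompact (C.SC (fun j => (lam j : ℝ)) (fun j => (lamBar j : ℝ))
        (fun i => (mu i : ℝ)) (fun i => (nu i : ℝ)) ∩
      {X | ∀ i j, C.IsDerivIndex i j → |C.rowDeriv X i j| ≤ M}) := by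
  have hcl : IsClosed {X : C.Arr | ∀ i j, C.IsDerivIndex i j → |C.rowDeriv X i j| ≤ M} := by
    simp only [Set.ofPred_forall, ← rowDerivL_apply]
    refine isClosed_iInter fun i => isClosed_iInter fun j => isClosed_iInter fun _ => ?_
    cases nonempty_fintype C.V
    exact isClosed_le (C.rowDerivL i j).continuous_of_finiteDimensional.abs continuous_const
  rcases Set.eq_empty_or_nonempty (C.SC (fun j => (lam j : ℝ)) (fun j => (lamBar j : ℝ))
        (fun i => (mu i : ℝ)) (fun i => (nu i : ℝ)) ∩
      {X | ∀ i j, C.IsDerivIndex i j → |C.rowDeriv X i j| ≤ M}) with h | ⟨S, hS, hSM⟩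
  · rw [h]; exact isCompact_empty
  · set B : C.Arr := fun v => 2 * M * (v.1.2 - C.a v.1.1) with hB
    refine (isCompact_Icc (a := S - B) (b := S + B)).of_isClosed_subset
      ((C.isPolyhedron_SC _ _ _ _).isClosed.inter hcl) fun X hX => ?_
    have key : ∀ v : C.V, |X v - S v| ≤ B v := fun v => by
      have := abs_entry_sub_entry_le hX.1 hX.2 hS hSM v.2.1 v.2.2.1 v.2.2.2
      rwa [entry_coe, entry_coe] at this
    refine ⟨fun v => ?_, fun v => ?_⟩
    · have := (abs_le.1 (key v)).1
      simp only [Pi.sub_apply]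
      linarith
    · have := (abs_le.1 (key v)).2
      simp only [Pi.add_apply]
      linarith

/-- A linear functional that is nonnegative on nonnegative arrays and attains its maximum over the
strip-concave arrays attains it at an integral array. -/
theorem exists_integral_maximizer (l : C.Arr →ₗ[ℝ] ℝ) (hl : ∀ Y : C.Arr, 0 ≤ Y → 0 ≤ l Y)
    {S : C.Arr} (hS : S ∈ C.SC (fun j => (lam j : ℝ)) (fun j => (lamBar j : ℝ))
      (fun i => (mu i : ℝ)) (fun i => (nu i : ℝ)))
    (hmax : ∀ X ∈ C.SC (fun j => (lam j : ℝ)) (fun j => (lamBar j : ℝ))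
      (fun i => (mu i : ℝ)) (fun i => (nu i : ℝ)), l X ≤ l S) :
    ∃ X ∈ C.SC (fun j => (lam j : ℝ)) (fun j => (lamBar j : ℝ))
      (fun i => (mu i : ℝ)) (fun i => (nu i : ℝ)), l S ≤ l X ∧ ∀ v, ∃ z : ℤ, X v = z := by
  cases nonempty_fintype C.V
  obtain ⟨M, hM⟩ : ∃ M : ℤ, ∀ i j, C.IsDerivIndex i j → |C.rowDeriv S i j| ≤ M := by
    obtain ⟨m, hm⟩ := (C.finite_isDerivIndex.image fun p => |C.rowDeriv S p.1 p.2|).bddAbove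
    exact ⟨⌈m⌉, fun i j h => (hm ⟨(i, j), h, rfl⟩).trans (Int.le_ceil m)⟩
  set K := (C.SC (fun j => (lam j : ℝ)) (fun j => (lamBar j : ℝ))
        (fun i => (mu i : ℝ)) (fun i => (nu i : ℝ)) ∩
      {X | ∀ i j, C.IsDerivIndex i j → |C.rowDeriv X i j| ≤ M}) ∩ {X | l S ≤ l X} with hK
  have hKc : IsCompact K := (isCompact_SC_bounded M).inter_right
    (isClosed_le continuous_const l.continuous_of_finiteDimensional)
  -- The sum of entries breaks ties: `l` may vanish on a nonzero nonnegative direction, whereas `σ`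
  -- is positive there.
  let σ : C.Arr →ₗ[ℝ] ℝ := ∑ v, LinearMap.proj (R := ℝ) (φ := fun _ : C.V => ℝ) v
  have hσ : ∀ Y, σ Y = ∑ v, Y v := fun Y => by simp [σ]
  obtain ⟨T, hT, hTmax⟩ := hKc.exists_isMaxOn ⟨S, ⟨hS, hM⟩, le_refl (l S)⟩
    σ.continuous_of_finiteDimensional.continuousOn
  have hFc : IsCompact (K ∩ {X | σ T ≤ σ X}) := hKc.inter_right
    (isClosed_le continuous_const σ.continuous_of_finiteDimensional)
  obtain ⟨X, hXF, hXext⟩ := hFc.extremePoints_nonempty ⟨T, hT, le_refl (σ T)⟩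
  obtain ⟨⟨⟨hX, hXM⟩, hXl⟩, hXσ⟩ := hXF
  have hXl : l S ≤ l X := hXl
  have hXσ : σ T ≤ σ X := hXσ
  refine ⟨X, hX, hXl, ?_⟩
  have hadj : ∀ i j, C.IsDerivIndex i j → C.IsDerivIndex i (j + 1) →
      C.rowDeriv X i (j + 1) = C.rowDeriv X i j → ∃ z : ℤ, C.rowDeriv X i j = z := by
    intro i j h h' e
    by_contra hni
    obtain ⟨Y, hY, hY0, ε, hε, hmem, hbd⟩ := exists_nonneg_direction hX hXM h h' e hni
    have h1 : σ (X + ε • Y) ≤ σ T := hTmax ⟨⟨hmem, hbd⟩, by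
      change l S ≤ l (X + ε • Y)
      rw [map_add, map_smul, smul_eq_mul]
      linarith [mul_nonneg hε.le (hl Y hY)]⟩
    have h2 : 0 < σ Y := by
      rw [hσ]
      exact Finset.sum_pos' (fun v _ => hY v) (by
        obtain ⟨v, hv⟩ := Function.ne_iff.1 hY0
        exact ⟨v, Finset.mem_univ v, lt_of_le_of_ne (hY v) (Ne.symm hv)⟩)
    rw [map_add, map_smul, smul_eq_mul] at h1
    linarith [mul_pos hε h2]
  have hint : ∀ i j, C.IsDerivIndex i j → ∃ z : ℤ, C.rowDeriv X i j = z := by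
    intro i j h
    by_contra hni
    obtain ⟨Y, hY0, h1, h2⟩ := exists_two_sided_direction hX hXM hadj h hni
    have l1 := hmax _ h1.1
    have l2 := hmax _ h2.1
    rw [map_add] at l1
    rw [map_sub] at l2
    -- Maximality at `X` in both directions `Y` and `-Y` forces `l Y = 0`, and below likewise `σ Y =
    -- 0`, so both endpoints lie in the set of which `X` is extreme.
    have k1 : X + Y ∈ K := ⟨h1, by change l S ≤ l (X + Y); rw [map_add]; linarith⟩
    have k2 : X - Y ∈ K := ⟨h2, by change l S ≤ l (X - Y); rw [map_sub]; linarith⟩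
    have s1 : σ (X + Y) ≤ σ T := hTmax k1
    have s2 : σ (X - Y) ≤ σ T := hTmax k2
    rw [map_add] at s1
    rw [map_sub] at s2
    have := hXext ⟨k1, by change σ T ≤ σ (X + Y); rw [map_add]; linarith⟩
      ⟨k2, by change σ T ≤ σ (X - Y); rw [map_sub]; linarith⟩
      ⟨1 / 2, 1 / 2, by norm_num, by norm_num, by norm_num, by
        rw [← smul_add, add_add_sub_cancel, ← two_smul ℝ X, smul_smul]; norm_num⟩
    exact hY0 (by simpa using this)
  intro v
  rw [← entry_coe X v]
  exact entry_int_of_rowDeriv_int hX (fun j hj => hint _ j hj) v.2.1 v.2.2.1 v.2.2.2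

end Integral

end ConvexShape

/-! ### Reduction of faces of the down hull to maximizers over strip-concave arrays. -/

theorem proposition2 {n : ℕ} (hn : 1 ≤ n) (C : ConvexShape n)
    (lam : Set.Icc (C.a n + 1) (C.b n) → ℤ) (lamBar : Set.Icc 1 (C.b 0) → ℤ)
    (mu nu : Fin n → ℤ) :
    IsIntegralPolyhedron
      (downHull (C.SC (fun j => (lam j : ℝ)) (fun j => (lamBar j : ℝ))
        (fun i => (mu i : ℝ)) (fun i => (nu i : ℝ)))) := by
  refine ⟨(C.isPolyhedron_SC _ _ _ _).downHull, fun F hF hne => ?_⟩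
  obtain ⟨l, rfl⟩ := hF hne
  obtain ⟨x, ⟨S, hS, r, hr, rfl⟩, hx⟩ := hne
  have hsub : ∀ T ∈ C.SC (fun j => (lam j : ℝ)) (fun j => (lamBar j : ℝ))
        (fun i => (mu i : ℝ)) (fun i => (nu i : ℝ)), ∀ Y : C.Arr, (∀ v, 0 ≤ Y v) →
        l (T - Y) ≤ l S - l r := fun T hT Y hY => by
    rw [← map_sub]
    exact hx _ ⟨T, hT, Y, hY, rfl⟩
  -- Lowering the maximizer `S - r` by `Y` stays in the down hull, so it cannot increase `l`.
  have hl : ∀ Y : C.Arr, 0 ≤ Y → 0 ≤ l Y := fun Y hY => by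
    have := hsub S hS (r + Y) fun v => add_nonneg (hr v) (hY v)
    rw [map_sub, map_add] at this
    linarith
  have hSC : ∀ T ∈ C.SC (fun j => (lam j : ℝ)) (fun j => (lamBar j : ℝ))
        (fun i => (mu i : ℝ)) (fun i => (nu i : ℝ)), l T ≤ l S - l r := fun T hT => by
    simpa using hsub T hT 0 fun v => le_rfl
  -- With `hSC` this shows that `S` itself maximizes `l` over the strip-concave arrays.
  have hr0 : 0 ≤ l r := hl r hr
  obtain ⟨X, hX, hXl, hXint⟩ := ConvexShape.exists_integral_maximizer l.toLinearMap hl hS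
    fun T hT => by
      have := hSC T hT
      change l T ≤ l S
      linarith
  have hXl : l S ≤ l X := hXl
  refine ⟨X, ⟨⟨X, hX, 0, fun v => le_rfl, sub_zero X⟩, ?_⟩, hXint⟩
  rintro _ ⟨T, hT, Y, hY, rfl⟩
  have h1 := hsub T hT Y hY
  change l (T - Y) ≤ l X
  linarith
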